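/- An $n\times n\times n$ Rubik's cube consists of $n^3$ cubies at the positions $(i,j,k)$ with $i,j,k\in\{0,\dots,n-1\}$. A configuration assigns one of six colors to each of the visible unit squares (stickers) of the six faces. A legal move rotates one slice (all cubies having a common value of one of the three coordinates, outer layers included) by $90^\circ$ in either direction. A configuration is solved if each face has a single color and the six faces have six different colors; a configuration $c$ is solvable if some sequence of legal moves takes it to a solved configuration $d$. A cubie cluster is a set $C$ of cubies (positions) such that every sequence of legal moves keeps the cubies of $C$ in $C$ and all other cubies out of $C$. A cluster $C$ has even parity in a configuration $c$, relative to a solved configuration $d$ reachable from $c$, if $c$ arises on $C$ from $d$ by moving the cubies of $C$ (each as a rigid body, by some rotation of the cube) according to an even permutation of $C$; here labels for indistinguishable cubies (such as centers of the same color) may be chosen freely. Lemma 2. There is an absolute constant $K$ such that for every $n$, every solvable configuration $c$ of the $n\times n\times n$ cube, and every solved configuration $d$ to which $c$ can be taken by legal moves, there is a sequence of at most $Kn$ legal moves which takes $c$ to a configuration in which every cubie cluster has even parity relative to $d$. In short, the parities of all cubie clusters can be made even in $O(n)$ moves. -/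

import Mathlib

namespace RubiksCube

/-- The positions `(i, j, k)`, `i, j, k ∈ {0, …, n - 1}`, of the `n³` cubies. -/
abbrev Pos (n : ℕ) : Type := Fin 3 → Fin n

/-- The six faces of the cube: `(a, false)` is the face on which the `a`-th coordinate is `0`,
and `(a, true)` is the face on which the `a`-th coordinate is `n - 1`. -/
abbrev Face : Type := Fin 3 × Bool

/-- A facelet is one of the six sides of a cubie, given by the position of the cubie and the
direction in which the side points. It may be hidden inside the cube. -/
abbrev Facelet (n : ℕ) : Type := Pos n × Face

/-- A facelet is visible if the cubie lies on the face of the cube to which the facelet points. -/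
def Visible {n : ℕ} (x : Facelet n) : Prop :=
  if x.2.2 = true then (x.1 x.2.1 : ℕ) + 1 = n else (x.1 x.2.1 : ℕ) = 0

/-- The visible facelets (`6 n²` of them when `n ≥ 1`). -/
abbrev Sticker (n : ℕ) : Type := {x : Facelet n // Visible x}

/-- Six colors. -/
abbrev Color : Type := Fin 6

/-- A configuration of the cube: a color on every visible facelet. -/
abbrev Config (n : ℕ) : Type := Sticker n → Color

/-- The rotation of the whole cube by 90 degrees about the axis `a`, acting on positions:
the axis `a + 1` is turned to the axis `a + 2`, and `a + 2` to the reverse of `a + 1`. -/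
def turnPos {n : ℕ} (a : Fin 3) : Equiv.Perm (Pos n) where
  toFun p i := if i = a + 1 then (p (a + 2)).rev else if i = a + 2 then p (a + 1) else p i
  invFun p i := if i = a + 1 then p (a + 2) else if i = a + 2 then (p (a + 1)).rev else p i
  left_inv p := by
    funext i
    fin_cases a <;> fin_cases i <;> simp
  right_inv p := by
    funext i
    fin_cases a <;> fin_cases i <;> simp

/-- The same rotation, acting on the six directions. -/
def turnFace (a : Fin 3) : Equiv.Perm Face where
  toFun f := if f.1 = a + 1 then (a + 2, f.2) else if f.1 = a + 2 then (a + 1, !f.2) else f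
  invFun f := if f.1 = a + 2 then (a + 1, f.2) else if f.1 = a + 1 then (a + 2, !f.2) else f
  left_inv f := by
    revert f
    revert a
    decide
  right_inv f := by
    revert f
    revert a
    decide

/-- The rotation of the whole cube by 90 degrees about the axis `a`, acting on facelets. -/
def turn {n : ℕ} (a : Fin 3) : Equiv.Perm (Facelet n) :=
  (turnPos a).prodCongr (turnFace a)

/-- The rotations of the whole cube, acting on facelets. -/
def rotations (n : ℕ) : Subgroup (Equiv.Perm (Facelet n)) :=
  Subgroup.closure (Set.range turn)

theorem turnPos_axis {n : ℕ} (a : Fin 3) (p : Pos n) : turnPos a p a = p a := by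
  fin_cases a <;> simp [turnPos]

theorem turnPos_symm_axis {n : ℕ} (a : Fin 3) (p : Pos n) : (turnPos a).symm p a = p a := by
  fin_cases a <;> simp [turnPos]

/-- Rotation by 90 degrees of the slice on which the `a`-th coordinate is `k`,
acting on positions. -/
def slicePos {n : ℕ} (a : Fin 3) (k : Fin n) : Equiv.Perm (Pos n) where
  toFun p := if p a = k then turnPos a p else p
  invFun p := if p a = k then (turnPos a).symm p else p
  left_inv p := by
    by_cases h : p a = k <;> simp [h, turnPos_axis]
  right_inv p := by
    by_cases h : p a = k <;> simp [h, turnPos_symm_axis]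

/-- Rotation by 90 degrees of the slice on which the `a`-th coordinate is `k`,
acting on facelets. -/
def sliceTurn {n : ℕ} (a : Fin 3) (k : Fin n) : Equiv.Perm (Facelet n) where
  toFun x := if x.1 a = k then turn a x else x
  invFun x := if x.1 a = k then (turn a).symm x else x
  left_inv x := by
    by_cases h : x.1 a = k
    · have h2 : (turn a x).1 a = k := by simp [turn, turnPos_axis, h]
      simp [h, h2]
    · simp [h]
  right_inv x := by
    by_cases h : x.1 a = k
    · have h2 : ((turn a).symm x).1 a = k := by simp [turn, turnPos_symm_axis, h]
      simp [h, h2]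
    · simp [h]

theorem visible_turn {n : ℕ} (a : Fin 3) (x : Facelet n) : Visible (turn a x) ↔ Visible x := by
  obtain ⟨p, i, s⟩ := x
  have h0 := (p 0).isLt
  have h1 := (p 1).isLt
  have h2 := (p 2).isLt
  fin_cases a <;> fin_cases i <;> cases s <;>
    simp [Visible, turn, turnPos, turnFace, Fin.val_rev] <;> omega

theorem visible_sliceTurn {n : ℕ} (a : Fin 3) (k : Fin n) (x : Facelet n) :
    Visible (sliceTurn a k x) ↔ Visible x := by
  by_cases h : x.1 a = k
  · simp [sliceTurn, h, visible_turn]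
  · simp [sliceTurn, h]

/-- The permutation of the stickers made by a 90 degree rotation of a slice. -/
def sliceSticker {n : ℕ} (a : Fin 3) (k : Fin n) : Equiv.Perm (Sticker n) :=
  (sliceTurn a k).subtypePerm (visible_sliceTurn a k)

/-- A legal move: a slice, given by the axis and the common coordinate of its cubies, and one of
the two directions in which it is rotated by 90 degrees. -/
structure Move (n : ℕ) where
  axis : Fin 3
  index : Fin n
  positive : Bool

/-- Where a legal move takes the cubie at a given position. -/
def Move.pos {n : ℕ} (m : Move n) : Equiv.Perm (Pos n) :=
  if m.positive = true then slicePos m.axis m.index else (slicePos m.axis m.index)⁻¹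

/-- Where a legal move takes the sticker at a given place. -/
def Move.sticker {n : ℕ} (m : Move n) : Equiv.Perm (Sticker n) :=
  if m.positive = true then sliceSticker m.axis m.index else (sliceSticker m.axis m.index)⁻¹

/-- The configuration after a legal move. -/
def applyMove {n : ℕ} (c : Config n) (m : Move n) : Config n :=
  fun s => c (m.sticker⁻¹ s)

/-- The configuration after a sequence of legal moves, the head of the list being made first. -/
def applyMoves {n : ℕ} (c : Config n) (w : List (Move n)) : Config n :=
  w.foldl applyMove c

/-- The position, after a sequence of legal moves, of the cubie that was at position `p`. -/
def movePos {n : ℕ} (p : Pos n) (w : List (Move n)) : Pos n :=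
  w.foldl (fun q m => m.pos q) p

/-- A configuration is solved if each face has a single color, different faces having
different colors. -/
def IsSolved {n : ℕ} (d : Config n) : Prop :=
  ∃ κ : Face → Color, Function.Injective κ ∧ ∀ s : Sticker n, d s = κ s.1.2

/-- `d` is a solution of `c`: a solved configuration to which some sequence of legal moves
takes `c`. A configuration is solvable if and only if it has a solution. -/
def IsSolutionOf {n : ℕ} (d c : Config n) : Prop :=
  IsSolved d ∧ ∃ w : List (Move n), applyMoves c w = d

/-- A cubie cluster: every sequence of legal moves keeps the cubies of the cluster in the cluster,
and the other cubies out of it. (The minimal nonempty clusters are the orbits of positions.) -/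
def IsCluster {n : ℕ} (C : Finset (Pos n)) : Prop :=
  ∀ (w : List (Move n)) (p : Pos n), movePos p w ∈ C ↔ p ∈ C

/-- `σ` is a labelling of the cluster `C` in the configuration `c`, relative to the solved
configuration `d`: for each `p ∈ C`, the cubie which is at `p` in the solved configuration can be
taken to be the one at `σ p` in the configuration `c`. That is, some rotation carries the place
`p` to the place `σ p` in such a way that the colors of `d` at `p` become those of `c` at `σ p`. -/
def IsLabelling {n : ℕ} (d c : Config n) (C : Finset (Pos n)) (σ : Equiv.Perm C) : Prop :=
  ∀ p : C, ∃ r ∈ rotations n, (∀ f : Face, (r (p, f)).1 = σ p) ∧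
    ∀ s t : Sticker n, s.1.1 = p → r s.1 = t.1 → c t = d s

/-- The cluster `C` has even parity in the configuration `c`, relative to the solved configuration
`d`: the cubies of `C` have been permuted by an even permutation. A choice of labels for
indistinguishable cubies is allowed; without indistinguishable cubies, the labelling is unique. -/
def HasEvenParity {n : ℕ} (d c : Config n) (C : Finset (Pos n)) : Prop :=
  ∃ σ : Equiv.Perm C, IsLabelling d c C σ ∧ Equiv.Perm.sign σ = 1

end RubiksCube

/-! A slice turn permutes each cluster with a sign that depends on the slice but not on the
direction. Signs multiply, so the sign of a word on any cluster depends only on which slices it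
turns an odd number of times. Let `v` take `d` to `c`. Turning each of its odd slices once more
costs at most `3 * n` moves, one per slice, and makes the sign +1 on all clusters at once
(`exists_moves_prod_eq_one`). The actual motion of the cubies under `v ++ w` is a valid labelling
(`exists_rotation_movePos`), so it witnesses even parity. -/

namespace RubiksCube

variable {n : ℕ}

/-- Where a legal move takes the facelet at a given place. -/
def Move.facelet (m : Move n) : Equiv.Perm (Facelet n) :=
  if m.positive = true then sliceTurn m.axis m.index else (sliceTurn m.axis m.index)⁻¹

/-- The slice rotated by a legal move. -/
def Move.slice (m : Move n) : Fin 3 × Fin n := (m.axis, m.index)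

/-- The legal move rotating the same slice in the other direction. -/
def Move.inv (m : Move n) : Move n := ⟨m.axis, m.index, !m.positive⟩

theorem Move.sticker_val (m : Move n) (s : Sticker n) : (m.sticker s).1 = m.facelet s.1 := by
  cases h : m.positive
  · simp only [Move.sticker, Move.facelet, h]
    rfl
  · simp only [Move.sticker, Move.facelet, h]
    rfl

theorem Move.sticker_inv (m : Move n) : m.inv.sticker = m.sticker⁻¹ := by
  cases h : m.positive <;> simp [Move.sticker, Move.inv, h]

theorem applyMove_inv (c : Config n) (m : Move n) : applyMove (applyMove c m) m.inv = c := by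
  funext s
  simp [applyMove, Move.sticker_inv]

theorem applyMoves_append (c : Config n) (v w : List (Move n)) :
    applyMoves c (v ++ w) = applyMoves (applyMoves c v) w :=
  List.foldl_append

theorem movePos_append_singleton (p : Pos n) (v : List (Move n)) (m : Move n) :
    movePos p (v ++ [m]) = m.pos (movePos p v) := by
  simp [movePos]

/-- Sequences of legal moves can be undone. -/
theorem exists_applyMoves_undo (c : Config n) (u : List (Move n)) :
    ∃ v : List (Move n), applyMoves (applyMoves c u) v = c := by
  induction u generalizing c with
  | nil => exact ⟨[], rfl⟩
  | cons m u ih =>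
    obtain ⟨v, hv⟩ := ih (applyMove c m)
    refine ⟨v ++ [m.inv], ?_⟩
    rw [applyMoves_append]
    change applyMove (applyMoves (applyMoves (applyMove c m) u) v) m.inv = c
    rw [hv, applyMove_inv]

/-- A legal move acts on each cubie as a rotation of the whole cube. -/
theorem Move.exists_rotation (m : Move n) (q : Pos n) :
    ∃ g ∈ rotations n, ∀ f : Face, g (q, f) = m.facelet (q, f) ∧ (g (q, f)).1 = m.pos q := by
  have ht : turn m.axis ∈ rotations n := Subgroup.subset_closure ⟨m.axis, rfl⟩
  by_cases hq : q m.axis = m.index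
  · cases h : m.positive
    · refine ⟨(turn m.axis)⁻¹, inv_mem ht, fun f => ⟨?_, ?_⟩⟩
      · simp only [Move.facelet, h]
        exact (if_pos hq).symm
      · simp only [Move.pos, h]
        exact (if_pos hq).symm
    · refine ⟨turn m.axis, ht, fun f => ⟨?_, ?_⟩⟩
      · simp only [Move.facelet, h]
        exact (if_pos hq).symm
      · simp only [Move.pos, h]
        exact (if_pos hq).symm
  -- A cubie outside the slice does not move.
  · refine ⟨1, one_mem _, fun f => ⟨?_, ?_⟩⟩
    · cases h : m.positive <;> simp only [Move.facelet, h] <;> exact (if_neg hq).symm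
    · cases h : m.positive <;> simp only [Move.pos, h] <;> exact (if_neg hq).symm

/-- A sequence of legal moves acts on each cubie, with its colors, as a rotation of the whole
cube. -/
theorem exists_rotation_movePos (d : Config n) (v : List (Move n)) (p : Pos n) :
    ∃ r ∈ rotations n, (∀ f : Face, (r (p, f)).1 = movePos p v) ∧
      ∀ s t : Sticker n, s.1.1 = p → r s.1 = t.1 → applyMoves d v t = d s := by
  induction v using List.reverseRecOn with
  | nil =>
    refine ⟨1, one_mem _, fun f => rfl, fun s t _ hst => ?_⟩
    obtain rfl : s = t := Subtype.ext hst
    rfl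
  | append_singleton v m ih =>
    obtain ⟨r, hr, hpos, hcol⟩ := ih
    obtain ⟨g, hg, hgm⟩ := m.exists_rotation (movePos p v)
    have hfst : ∀ x : Facelet n, x.1 = p → r x = (movePos p v, (r x).2) := by
      rintro ⟨x, f⟩ rfl
      exact Prod.ext (hpos f) rfl
    refine ⟨g * r, mul_mem hg hr, fun f => ?_, fun s t hs hst => ?_⟩
    · rw [Equiv.Perm.mul_apply, hfst (p, f) rfl, (hgm _).2, movePos_append_singleton]
    · rw [applyMoves_append]
      change applyMoves d v (m.sticker⁻¹ t) = d s
      -- It remains to see that `r` carries `s` to the preimage of `t` under `m`. This is checked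
      -- after applying `m`, which agrees with `g` on the cubie at `movePos p v`.
      refine hcol s _ hs (m.facelet.injective ?_)
      rw [← Move.sticker_val, show m.sticker (m.sticker⁻¹ t) = t from m.sticker.apply_symm_apply t,
        ← hst, Equiv.Perm.mul_apply,
        hfst s.1 hs, (hgm _).1]

theorem IsCluster.slicePos_mem_iff {C : Finset (Pos n)} (hC : IsCluster C) (x : Fin 3 × Fin n)
    (p : Pos n) : slicePos x.1 x.2 p ∈ C ↔ p ∈ C :=
  hC [⟨x.1, x.2, true⟩] p

/-- The sign of the permutation of a cluster made by a 90 degree rotation of a slice. -/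
def IsCluster.sliceSign {C : Finset (Pos n)} (hC : IsCluster C) (x : Fin 3 × Fin n) : ℤˣ :=
  Equiv.Perm.sign ((slicePos x.1 x.2).subtypePerm (hC.slicePos_mem_iff x))

/-- A permutation and its inverse have the same sign, so the direction of the move is irrelevant. -/
theorem IsCluster.exists_perm_move {C : Finset (Pos n)} (hC : IsCluster C) (m : Move n) :
    ∃ τ : Equiv.Perm C, (∀ p : C, (τ p : Pos n) = m.pos p) ∧
      Equiv.Perm.sign τ = hC.sliceSign m.slice := by
  cases h : m.positive
  · refine ⟨((slicePos m.axis m.index).subtypePerm (hC.slicePos_mem_iff m.slice))⁻¹,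
      fun p => ?_, Equiv.Perm.sign_inv _⟩
    simp only [Move.pos, h]
    rfl
  · refine ⟨(slicePos m.axis m.index).subtypePerm (hC.slicePos_mem_iff m.slice),
      fun p => ?_, rfl⟩
    simp only [Move.pos, h]
    rfl

/-- The permutation of a cluster made by a sequence of legal moves, and its sign. -/
theorem IsCluster.exists_perm_movePos {C : Finset (Pos n)} (hC : IsCluster C)
    (v : List (Move n)) :
    ∃ σ : Equiv.Perm C, (∀ p : C, (σ p : Pos n) = movePos p v) ∧
      Equiv.Perm.sign σ = (v.map fun m => hC.sliceSign m.slice).prod := by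
  induction v using List.reverseRecOn with
  | nil => exact ⟨1, fun p => rfl, Equiv.Perm.sign_one⟩
  | append_singleton v m ih =>
    obtain ⟨σ, hσ, hs⟩ := ih
    obtain ⟨τ, hτ, ht⟩ := hC.exists_perm_move m
    refine ⟨τ * σ, fun p => ?_, ?_⟩
    · rw [Equiv.Perm.mul_apply, hτ, hσ, movePos_append_singleton]
    · rw [Equiv.Perm.sign_mul, hs, ht, mul_comm]
      simp

/-- A product of signs is the product over the factors that occur an odd number of times. -/
theorem exists_finset_prod_eq {ι : Type*} [DecidableEq ι] (l : List ι) :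
    ∃ S : Finset ι, ∀ ε : ι → ℤˣ, (l.map ε).prod = ∏ x ∈ S, ε x := by
  induction l with
  | nil => exact ⟨∅, fun ε => rfl⟩
  | cons a l ih =>
    obtain ⟨S, hS⟩ := ih
    -- A further occurrence of `a` toggles its membership in `S`, since signs square to 1. The
    -- choice does not involve `ε`.
    by_cases ha : a ∈ S
    · refine ⟨S.erase a, fun ε => ?_⟩
      rw [List.map_cons, List.prod_cons, hS, ← Finset.mul_prod_erase S ε ha, ← mul_assoc,
        Int.units_mul_self, one_mul]
    · refine ⟨insert a S, fun ε => ?_⟩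
      rw [List.map_cons, List.prod_cons, hS, Finset.prod_insert ha]

/-- Every sequence of legal moves can be extended by at most `3 n` moves in such a way that each
slice is rotated an even number of times. -/
theorem exists_moves_prod_eq_one (v : List (Move n)) :
    ∃ w : List (Move n), w.length ≤ 3 * n ∧
      ∀ ε : Fin 3 × Fin n → ℤˣ, ((v ++ w).map fun m => ε m.slice).prod = 1 := by
  obtain ⟨S, hS⟩ := exists_finset_prod_eq (v.map Move.slice)
  -- Either direction would do; `S` lies in `Fin 3 × Fin n`, whence the bound.
  refine ⟨S.toList.map fun x => ⟨x.1, x.2, true⟩, ?_, fun ε => ?_⟩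
  · simpa using S.card_le_univ
  · have hv : (v.map fun m => ε m.slice).prod = ∏ x ∈ S, ε x := by
      rw [← hS, List.map_map]
      rfl
    have hw : ((S.toList.map fun x => (⟨x.1, x.2, true⟩ : Move n)).map
        fun m => ε m.slice).prod = ∏ x ∈ S, ε x := by
      rw [List.map_map]
      exact Finset.prod_map_toList S ε
    rw [List.map_append, List.prod_append, hv, hw, Int.units_mul_self]

end RubiksCube

theorem lemma2 : ∃ K : ℕ, ∀ (n : ℕ) (c d : RubiksCube.Config n), RubiksCube.IsSolutionOf d c →
    ∃ w : List (RubiksCube.Move n), w.length ≤ K * n ∧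
      ∀ C : Finset (RubiksCube.Pos n), RubiksCube.IsCluster C →
        RubiksCube.HasEvenParity d (RubiksCube.applyMoves c w) C := by
  refine ⟨3, fun n c d ⟨_, u, hu⟩ => ?_⟩
  -- Reversing the solution presents `c` as a scramble of `d`.
  obtain ⟨v, hv⟩ := RubiksCube.exists_applyMoves_undo c u
  rw [hu] at hv
  obtain ⟨w, hlen, hw⟩ := RubiksCube.exists_moves_prod_eq_one v
  refine ⟨w, hlen, fun C hC => ?_⟩
  obtain ⟨σ, hσ, hsign⟩ := hC.exists_perm_movePos (v ++ w)
  -- `hw` holds for every sign function on slices, so the same `w` serves all clusters.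
  refine ⟨σ, fun p => ?_, hsign.trans (hw _)⟩
  rw [← hv, ← RubiksCube.applyMoves_append, hσ]
  exact RubiksCube.exists_rotation_movePos d (v ++ w) p
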